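/- Let $\Sigma$ be a finite alphabet and $\mathfrak D$ an infinite set of data values; a data word is a finite sequence $w=\binom{\sigma_1}{a_1}\cdots\binom{\sigma_n}{a_n}$ over $\Sigma\times\mathfrak D$. Let $\triangleleft,\triangleright$ be two distinct markers outside $\Sigma\cup\mathfrak D$, and put $\sigma_0=a_0=\triangleleft$, $\sigma_{n+1}=a_{n+1}=\triangleright$. A *one-way alternating weak $k$-PA* over $\Sigma$ consists of a finite set $Q$ of states, an initial state $q_0\in Q$, a set $F\subseteq Q$ of final states, a set $U\subseteq Q\setminus F$ of universal states and a set $\mu$ of transitions $(i,\sigma,V,q)\to(p,\mathtt{act})$ with $1\le i\le k$, $\sigma\in\Sigma\cup\{\triangleleft,\triangleright\}$, $V\subseteq\{i+1,\dots,k\}$, $q,p\in Q$ and $\mathtt{act}\in\{\mathtt{stay},\mathtt{right},\mathtt{place\text{-}pebble},\mathtt{lift\text{-}pebble}\}$. A configuration on $\triangleleft w\triangleright$ is a triple $[i,q,\theta]$ with $1\le i\le k$, $q\in Q$ and $\theta:\{i,\dots,k\}\to\{0,\dots,n+1\}$; the initial one is $[k,q_0,\theta_0]$ with $\theta_0(k)=0$.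 The transition above applies to $[j,q',\theta]$ if $j=i$, $q'=q$, $\sigma_{\theta(i)}=\sigma$ and $V=\{l>i: a_{\theta(l)}=a_{\theta(i)}\}$. It then leads to a configuration in state $p$ in which all pebbles $l>i$ keep their positions, where: under $\mathtt{stay}$ nothing else changes; under $\mathtt{right}$ pebble $i$ moves one position to the right; under $\mathtt{place\text{-}pebble}$ pebble $i$ stays where it is and pebble $i-1$ is placed at the same position and becomes the head pebble; under $\mathtt{lift\text{-}pebble}$ pebble $i$ is removed and pebble $i+1$ becomes the head pebble. If the result would not be a configuration (moving right from $\triangleright$, placing with $i=1$, lifting with $i=k$), there is no successor. "Leads to acceptance" is the least property of configurations such that a configuration has it if its state is in $F$, or its state is in $U$ and all its successors have it, or its state is in neither $F$ nor $U$ and some successor has it. The word $w$ is accepted if the initial configuration on $\triangleleft w\triangleright$ leads to acceptance. The automaton is *nondeterministic* if $U=\emptyset$, and *deterministic* if for every data word and every configuration on it exactly one transition applies. A *top view weak $k$-PA* is defined in the same way, except that the head pebble $i$ is compared only with pebble $i+1$: in each transition $V\subseteq\{i+1\}\cap\{1,\dots,k\}$, and the condition on $V$ is $V=\{l\in\{i+1\}\cap\{1,\dots,k\}: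 a_{\theta(l)}=a_{\theta(i)}\}$. **Theorem.** For every $k\ge 1$ and every data language $L\subseteq(\Sigma\times\mathfrak D)^*$ the following are equivalent: (1) $L$ is accepted by an alternating weak $k$-PA; (2) $L$ is accepted by a nondeterministic weak $k$-PA; (3) $L$ is accepted by a deterministic weak $k$-PA; (4) $L$ is accepted by a deterministic weak $k$-PA without universal states. The same equivalence holds with "top view weak $k$-PA" in place of "weak $k$-PA" throughout. -/

import Mathlib

/-- The set `α` extended by the left-end marker and the right-end marker. -/
inductive Marked (α : Type*) where
  | leftEnd : Marked α
  | mid (a : α) : Marked α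
  | rightEnd : Marked α

/-- The symbol at position `p` of the marked word: position `0` carries the left-end marker,
positions `1, …, n` carry the letters of `w`, and position `n + 1` the right-end marker. -/
def symbolAt {α : Type*} (w : List α) : ℕ → Marked α
  | 0 => Marked.leftEnd
  | p + 1 => match w[p]? with
    | some a => Marked.mid a
    | none => Marked.rightEnd

/-- The label `σ_p` of position `p` of a marked data word. -/
def labelAt {α D : Type*} (w : List (α × D)) (p : ℕ) : Marked α :=
  symbolAt (w.map Prod.fst) p

/-- The data value `a_p` of position `p` of a marked data word. An end marker is its own data
value: it differs from all elements of `D` and from the other end marker. -/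
def dataAt {α D : Type*} (w : List (α × D)) (p : ℕ) : Marked D :=
  symbolAt (w.map Prod.snd) p

inductive PebbleAction where
  | stay
  | right
  | placePebble
  | liftPebble

/-- Which earlier pebbles the head pebble may be compared with: all of them (`full`, the ordinary
weak automata), or only the one placed last before it (`top`, the top view weak automata). -/
inductive PebbleView where
  | full
  | top

/-- The pebbles with which the head pebble `i` may be compared. Pebbles are numbered downwards, so
the earlier pebbles are those with a larger number. -/
def PebbleView.scope {k : ℕ} : PebbleView → Fin k → Set (Fin k)
  | .full, i => {l | i < l}
  | .top, i => {l | (l : ℕ) = (i : ℕ) + 1}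

/-- A transition `(head, label, equal, source) → (target, act)`. The elements `0, …, k - 1` of
`Fin k` stand for the pebbles `1, …, k`. -/
structure PebbleTransition (α : Type*) (k : ℕ) (Q : Type) where
  head : Fin k
  label : Marked α
  equal : Set (Fin k)
  source : Q
  target : Q
  act : PebbleAction

/-- One-way alternating weak `k`-pebble automata over the alphabet `α` (top view ones if the view
is `top`). -/
structure WeakPA (view : PebbleView) (α : Type*) (k : ℕ) where
  State : Type
  finite_state : Finite State
  initial : State
  final : Set State
  univ : Set State
  univ_subset : univ ⊆ finalᶜ
  trans : Set (PebbleTransition α k State)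
  equal_subset : ∀ t ∈ trans, t.equal ⊆ view.scope t.head

/-- A configuration on a word of length `n`: the head pebble, the state, and the positions of the
pebbles. Only the positions of the pebbles `l ≥ head` matter: the others are not on the word, and
their values `pos l` are never read. -/
structure PebbleConfig (k : ℕ) (Q : Type) (n : ℕ) where
  head : Fin k
  state : Q
  pos : Fin k → Fin (n + 2)

/-- `PebbleMove act i θ i' θ'`: the action `act`, performed with head pebble `i` under the
assignment `θ`, gives the head pebble `i'` and the assignment `θ'`. No move goes right from the
right-end marker, places a pebble below the lowest one, or lifts the highest one. -/
inductive PebbleMove {k n : ℕ} : PebbleAction → Fin k → (Fin k → Fin (n + 2)) →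
    Fin k → (Fin k → Fin (n + 2)) → Prop
  | stay (i : Fin k) (θ : Fin k → Fin (n + 2)) : PebbleMove .stay i θ i θ
  | right (i : Fin k) (θ : Fin k → Fin (n + 2)) (p : Fin (n + 2)) (h : (p : ℕ) = (θ i : ℕ) + 1) :
      PebbleMove .right i θ i (Function.update θ i p)
  | placePebble (i j : Fin k) (θ : Fin k → Fin (n + 2)) (h : (j : ℕ) + 1 = (i : ℕ)) :
      PebbleMove .placePebble i θ j (Function.update θ j (θ i))
  | liftPebble (i j : Fin k) (θ : Fin k → Fin (n + 2)) (h : (j : ℕ) = (i : ℕ) + 1) :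
      PebbleMove .liftPebble i θ j θ

namespace WeakPA

variable {view : PebbleView} {α D : Type*} {k : ℕ}

/-- The transition `t` applies to the configuration `γ` on the marked word `w`. -/
def Applies (A : WeakPA view α k) (w : List (α × D)) (t : PebbleTransition α k A.State)
    (γ : PebbleConfig k A.State w.length) : Prop :=
  t.head = γ.head ∧ t.source = γ.state ∧
    t.equal = {l | l ∈ view.scope γ.head ∧ dataAt w (γ.pos l) = dataAt w (γ.pos γ.head)} ∧
    labelAt w (γ.pos γ.head) = t.label

/-- The one-step relation on configurations. -/
def Step (A : WeakPA view α k) (w : List (α × D))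
    (γ γ' : PebbleConfig k A.State w.length) : Prop :=
  ∃ t ∈ A.trans, A.Applies w t γ ∧ γ'.state = t.target ∧
    PebbleMove t.act γ.head γ.pos γ'.head γ'.pos

/-- The configuration leads to acceptance. -/
inductive LeadsToAcceptance (A : WeakPA view α k) (w : List (α × D)) :
    PebbleConfig k A.State w.length → Prop
  | final (γ : PebbleConfig k A.State w.length) (hF : γ.state ∈ A.final) :
      LeadsToAcceptance A w γ
  | univ (γ : PebbleConfig k A.State w.length) (hU : γ.state ∈ A.univ)
      (h : ∀ γ', A.Step w γ γ' → LeadsToAcceptance A w γ') : LeadsToAcceptance A w γ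
  | exist (γ γ' : PebbleConfig k A.State w.length) (hF : γ.state ∉ A.final)
      (hU : γ.state ∉ A.univ) (hs : A.Step w γ γ') (h : LeadsToAcceptance A w γ') :
      LeadsToAcceptance A w γ

/-- The initial configuration: the highest pebble is the head and stands on the left-end marker. -/
def initialConfig [NeZero k] (A : WeakPA view α k) (n : ℕ) : PebbleConfig k A.State n where
  head := ⊤
  state := A.initial
  pos := fun _ => 0

/-- The data language accepted by the automaton, over the data values `D`. -/
def language [NeZero k] (A : WeakPA view α k) (D : Type*) : Set (List (α × D)) :=
  {w | A.LeadsToAcceptance w (A.initialConfig w.length)}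

/-- There are no universal states. -/
def IsNondeterministic (A : WeakPA view α k) : Prop :=
  A.univ = ∅

/-- Exactly one transition applies to each configuration. -/
def IsDeterministic (A : WeakPA view α k) (D : Type*) : Prop :=
  ∀ (w : List (α × D)) (γ : PebbleConfig k A.State w.length),
    ∃! t : PebbleTransition α k A.State, t ∈ A.trans ∧ A.Applies w t γ

end WeakPA

/-! Pebbles never move left, and a new pebble starts where the one above it stands. So acceptance
with head pebble `i` depends on what follows its lifting only through the set `X` of states
accepting then: `value` is a monotone map of `X`, defined by recursion on the pebble and on the
distance to the right end. At a single position, stays and excursions of pebble `i - 1` can form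
loops; a least fixed point resolves them. `mem_language_iff` reads acceptance off the value of the
highest pebble.

There are finitely many maps between sets of states, so a deterministic automaton can keep such maps
in its own state. Values propagate from right to left while the head runs from left to right; hence
each pebble accumulates the map that turns the value at its current position into the value at its
starting position. At every position it first sends out the next pebble, which returns with its own
value as a map. `exists_detAccepts_finish` proves this run correct, and (1) → (4) follows; the other
implications only drop properties. Both views are treated at once: all that matters is
`lt_of_mem_scope`. -/

/-! ### Labels, equal data values and moves -/

namespace PebbleView

theorem lt_of_mem_scope {k : ℕ} {view : PebbleView} {i l : Fin k} (h : l ∈ view.scope i) :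
    i < l := by
  cases view with
  | full => exact h
  | top =>
    have h' : (l : ℕ) = (i : ℕ) + 1 := h
    exact Fin.lt_def.2 (by omega)

end PebbleView

theorem labelAt_eq_rightEnd_iff {α D : Type*} (w : List (α × D)) (p : ℕ) :
    labelAt w p = Marked.rightEnd ↔ w.length + 1 ≤ p := by
  unfold labelAt
  cases p with
  | zero => simp [symbolAt]
  | succ p =>
    by_cases h : p < w.length
    · simp [symbolAt, h]
    · have h' : w.length ≤ p := not_lt.1 h
      simp [symbolAt, h']

/-- The earlier pebbles in view that carry the data value of the head pebble `i`. -/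
def equalPebbles {α D : Type*} {k : ℕ} (view : PebbleView) (w : List (α × D)) (i : Fin k)
    (θ : Fin k → Fin (w.length + 2)) : Set (Fin k) :=
  {l | l ∈ view.scope i ∧ dataAt w (θ l) = dataAt w (θ i)}

theorem equalPebbles_congr {α D : Type*} {k : ℕ} (view : PebbleView) (w : List (α × D))
    {i : Fin k} {θ θ' : Fin k → Fin (w.length + 2)} (h : ∀ l, i ≤ l → θ' l = θ l) :
    equalPebbles view w i θ' = equalPebbles view w i θ := by
  ext l
  simp only [equalPebbles, Set.mem_ofPred_eq, h i le_rfl]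
  exact and_congr_right fun hl => by rw [h l (PebbleView.lt_of_mem_scope hl).le]

theorem not_top_val_add_one_lt (k : ℕ) [NeZero k] : ¬ (((⊤ : Fin k) : ℕ) + 1 < k) := fun h =>
  absurd (le_top (a := (⟨(⊤ : Fin k) + 1, h⟩ : Fin k)))
    (not_le_of_gt (Fin.lt_def.2 (by simp only; omega)))

namespace PebbleMove

theorem unique {k n : ℕ} {a : PebbleAction} {i i₁ i₂ : Fin k} {θ θ₁ θ₂ : Fin k → Fin (n + 2)}
    (h₁ : PebbleMove a i θ i₁ θ₁) (h₂ : PebbleMove a i θ i₂ θ₂) : i₁ = i₂ ∧ θ₁ = θ₂ := by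
  cases h₁ with
  | stay => cases h₂; exact ⟨rfl, rfl⟩
  | right _ _ p hp =>
    cases h₂ with
    | right _ _ p' hp' =>
      obtain rfl : p = p' := Fin.ext (hp.trans hp'.symm)
      exact ⟨rfl, rfl⟩
  | placePebble _ _ _ hj =>
    cases h₂ with
    | placePebble _ _ _ hj' =>
      obtain rfl : i₁ = i₂ := Fin.ext (by omega)
      exact ⟨rfl, rfl⟩
  | liftPebble _ _ _ hj =>
    cases h₂ with
    | liftPebble _ _ _ hj' =>
      obtain rfl : i₁ = i₂ := Fin.ext (by omega)
      exact ⟨rfl, rfl⟩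

end PebbleMove

/-! ### Acceptance at a fixed position as a least fixed point -/

namespace PebbleTransition

variable {α : Type*} {k : ℕ} {Q : Type}

/-- The transition has a successor wherever it applies. -/
def Enabled (t : PebbleTransition α k Q) : Prop :=
  match t.act with
  | .stay => True
  | .right => t.label ≠ Marked.rightEnd
  | .placePebble => 0 < (t.head : ℕ)
  | .liftPebble => (t.head : ℕ) + 1 < k

/-- The successor under `t` is accepting, if the accepting states are `Y` at the current position,
`R` one position to the right, `X` after lifting the head pebble, and `G Y` after placing the next
pebble. -/
def Succeeds (G : Set Q → Set Q) (X R Y : Set Q) (t : PebbleTransition α k Q) : Prop :=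
  match t.act with
  | .stay => t.target ∈ Y
  | .right => t.target ∈ R
  | .placePebble => t.target ∈ G Y
  | .liftPebble => t.target ∈ X

theorem Succeeds.mono {G G' : Set Q → Set Q} {X X' R R' Y Y' : Set Q}
    {t : PebbleTransition α k Q} (hG : G Y ⊆ G' Y') (hX : X ⊆ X') (hR : R ⊆ R') (hY : Y ⊆ Y')
    (h : t.Succeeds G X R Y) : t.Succeeds G' X' R' Y' := by
  unfold Succeeds at *
  cases ht : t.act <;> simp only [ht] at h ⊢
  exacts [hY h, hR h, hG h, hX h]

end PebbleTransition

namespace WeakPA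

variable {view : PebbleView} {α D : Type*} {k : ℕ}

/-- The enabled transitions for head pebble `i` in state `q`, reading the label `σ` and the set `V`
of pebbles with an equal data value. -/
def enabledTrans (A : WeakPA view α k) (i : Fin k) (σ : Marked α) (V : Set (Fin k))
    (q : A.State) : Set (PebbleTransition α k A.State) :=
  {t | t ∈ A.trans ∧ t.Enabled ∧ t.head = i ∧ t.label = σ ∧ t.equal = V ∧ t.source = q}

/-- One round of evaluation of the acceptance condition at a fixed position. -/
def evalStep (A : WeakPA view α k) (i : Fin k) (σ : Marked α) (V : Set (Fin k))
    (G : Set A.State → Set A.State) (X R Y : Set A.State) : Set A.State :=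
  {q | q ∈ A.final ∨
    (q ∈ A.univ ∧ ∀ t ∈ A.enabledTrans i σ V q, t.Succeeds G X R Y) ∨
    (q ∉ A.final ∧ q ∉ A.univ ∧ ∃ t ∈ A.enabledTrans i σ V q, t.Succeeds G X R Y)}

/-- The least set of states that is closed under evaluation at a fixed position. -/
def evalLocal (A : WeakPA view α k) (i : Fin k) (σ : Marked α) (V : Set (Fin k))
    (G : Set A.State → Set A.State) (X R : Set A.State) : Set A.State :=
  ⋂₀ {Y | A.evalStep i σ V G X R Y ⊆ Y}

section Eval

variable (A : WeakPA view α k) (i : Fin k) (σ : Marked α) (V : Set (Fin k))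
  {G G' : Set A.State → Set A.State} {X X' R R' Y Y' : Set A.State}

theorem evalStep_mono (hG : G Y ⊆ G' Y') (hX : X ⊆ X') (hR : R ⊆ R') (hY : Y ⊆ Y') :
    A.evalStep i σ V G X R Y ⊆ A.evalStep i σ V G' X' R' Y' := by
  rintro q (h | ⟨hU, h⟩ | ⟨hF, hU, t, ht, h⟩)
  · exact Or.inl h
  · exact Or.inr (Or.inl ⟨hU, fun t ht => (h t ht).mono hG hX hR hY⟩)
  · exact Or.inr (Or.inr ⟨hF, hU, t, ht, h.mono hG hX hR hY⟩)

theorem evalLocal_subset (h : A.evalStep i σ V G X R Y ⊆ Y) : A.evalLocal i σ V G X R ⊆ Y :=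
  Set.sInter_subset_of_mem h

theorem evalLocal_mono (hG : ∀ Y, G Y ⊆ G' Y) (hX : X ⊆ X') (hR : R ⊆ R') :
    A.evalLocal i σ V G X R ⊆ A.evalLocal i σ V G' X' R' :=
  Set.subset_sInter fun Y hY =>
    A.evalLocal_subset i σ V ((A.evalStep_mono i σ V (hG Y) hX hR subset_rfl).trans hY)

/-- The Knaster–Tarski argument. Monotonicity of `G` is needed because the set being computed is
also the set to which the placed pebble returns. -/
theorem evalStep_evalLocal_subset (hG : Monotone G) :
    A.evalStep i σ V G X R (A.evalLocal i σ V G X R) ⊆ A.evalLocal i σ V G X R :=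
  Set.subset_sInter fun Y hY =>
    have h : A.evalLocal i σ V G X R ⊆ Y := A.evalLocal_subset i σ V hY
    (A.evalStep_mono i σ V (hG h) subset_rfl subset_rfl h).trans hY

end Eval

/-! ### Values by recursion on pebble and position -/

/-- The states that lead to acceptance with head pebble `i` under the assignment `θ`, if lifting
pebble `i` in a transition to the state `q` counts as accepting for `q ∈ X`. -/
def value (A : WeakPA view α k) (w : List (α × D)) (i : Fin k) (θ : Fin k → Fin (w.length + 2))
    (X : Set A.State) : Set A.State :=
  A.evalLocal i (labelAt w (θ i)) (equalPebbles view w i θ)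
    (fun Y => if 0 < (i : ℕ) then
      value A w ⟨i - 1, by omega⟩ (Function.update θ ⟨i - 1, by omega⟩ (θ i)) Y else ∅)
    X
    (if h : (θ i : ℕ) + 1 < w.length + 2 then
      value A w i (Function.update θ i ⟨θ i + 1, h⟩) X else ∅)
termination_by ((i : ℕ), w.length + 2 - (θ i : ℕ))
decreasing_by
  · exact Prod.Lex.left _ _ (by omega)
  · exact Prod.Lex.right _ (by simp only [Function.update_self]; omega)

/-- The value after placing the next pebble, as a function of the states accepting on return. -/
def placeValue (A : WeakPA view α k) (w : List (α × D)) (i : Fin k)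
    (θ : Fin k → Fin (w.length + 2)) (Y : Set A.State) : Set A.State :=
  if 0 < (i : ℕ) then
    value A w ⟨i - 1, by omega⟩ (Function.update θ ⟨i - 1, by omega⟩ (θ i)) Y else ∅

/-- The value one position to the right. -/
def rightValue (A : WeakPA view α k) (w : List (α × D)) (i : Fin k)
    (θ : Fin k → Fin (w.length + 2)) (X : Set A.State) : Set A.State :=
  if h : (θ i : ℕ) + 1 < w.length + 2 then
    value A w i (Function.update θ i ⟨θ i + 1, h⟩) X else ∅

section Value

variable (A : WeakPA view α k) (w : List (α × D))

theorem value_eq (i : Fin k) (θ : Fin k → Fin (w.length + 2)) (X : Set A.State) :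
    A.value w i θ X = A.evalLocal i (labelAt w (θ i)) (equalPebbles view w i θ)
      (A.placeValue w i θ) X (A.rightValue w i θ X) := by
  rw [value]
  rfl

theorem placeValue_eq {i j : Fin k} (hj : (j : ℕ) + 1 = i) (θ : Fin k → Fin (w.length + 2)) :
    A.placeValue w i θ = A.value w j (Function.update θ j (θ i)) := by
  obtain ⟨i, hi⟩ := i
  obtain ⟨j, hj'⟩ := j
  obtain rfl : j + 1 = i := hj
  funext Y
  simp [placeValue]

theorem rightValue_eq {i : Fin k} {θ : Fin k → Fin (w.length + 2)} {p : Fin (w.length + 2)}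
    (hp : (p : ℕ) = θ i + 1) (X : Set A.State) :
    A.rightValue w i θ X = A.value w i (Function.update θ i p) X := by
  have hlt : (θ i : ℕ) + 1 < w.length + 2 := by omega
  obtain rfl : p = ⟨θ i + 1, hlt⟩ := Fin.ext hp
  simp only [rightValue, dif_pos hlt]

/-- Induction to the right only: `X` does not enter the place map, so the lower pebbles play no
role. -/
theorem value_mono (i : Fin k) (θ : Fin k → Fin (w.length + 2)) : Monotone (A.value w i θ) := by
  intro X X' hX
  rw [value_eq, value_eq]
  refine A.evalLocal_mono _ _ _ (fun _ => subset_rfl) hX ?_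
  unfold rightValue
  split_ifs with h
  · exact value_mono i (Function.update θ i ⟨θ i + 1, h⟩) hX
  · exact subset_rfl
termination_by w.length + 2 - (θ i : ℕ)
decreasing_by simp only [Function.update_self]; omega

theorem placeValue_mono (i : Fin k) (θ : Fin k → Fin (w.length + 2)) :
    Monotone (A.placeValue w i θ) := by
  intro X X' hX
  unfold placeValue
  split_ifs
  · exact A.value_mono w _ _ hX
  · exact subset_rfl

/-- Serves both moving right (`j = i`) and placing (`j + 1 = i`). -/
theorem update_congr_above {n : ℕ} {i j : Fin k} {θ θ' : Fin k → Fin n} (p : Fin n)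
    (hij : (i : ℕ) ≤ j + 1) (h : ∀ l, i ≤ l → θ' l = θ l) (l : Fin k) (hl : j ≤ l) :
    Function.update θ' j p l = Function.update θ j p l := by
  rcases eq_or_ne l j with rfl | hne
  · simp
  · rw [Function.update_of_ne hne, Function.update_of_ne hne]
    have : (l : ℕ) ≠ j := fun e => hne (Fin.ext e)
    exact h l (Fin.le_def.2 (by have := Fin.le_def.1 hl; omega))

/-- A lower pebble is read only after placing has overwritten its position. -/
theorem value_congr (i : Fin k) (θ θ' : Fin k → Fin (w.length + 2))
    (h : ∀ l, i ≤ l → θ' l = θ l) : A.value w i θ' = A.value w i θ := by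
  have hi := h i le_rfl
  have hplace : A.placeValue w i θ' = A.placeValue w i θ := by
    funext Y
    unfold placeValue
    split_ifs with h0
    · rw [hi]
      exact congrFun (value_congr _ _ _ (update_congr_above _ (by simp only; omega) h)) Y
    · rfl
  have hright : A.rightValue w i θ' = A.rightValue w i θ := by
    funext X
    unfold rightValue
    simp only [hi]
    split_ifs with hr
    · exact congrFun (value_congr _ _ _ (update_congr_above _ (by omega) h)) X
    · rfl
  funext X
  rw [value_eq, value_eq, hi, equalPebbles_congr view w h, hplace, hright]
termination_by ((i : ℕ), w.length + 2 - (θ i : ℕ))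
decreasing_by
  · exact Prod.Lex.left _ _ (by omega)
  · exact Prod.Lex.right _ (by simp only [Function.update_self]; omega)

/-! ### Soundness of the values -/

/-- The states that lead to acceptance with head pebble `i` wherever the pebbles below `i` are. -/
def acceptingStates (i : Fin k) (θ : Fin k → Fin (w.length + 2)) : Set A.State :=
  {q | ∀ θ' : Fin k → Fin (w.length + 2), (∀ l, i ≤ l → θ' l = θ l) →
    A.LeadsToAcceptance w ⟨i, q, θ'⟩}

theorem acceptingStates_congr (i : Fin k) (θ θ' : Fin k → Fin (w.length + 2))
    (h : ∀ l, i ≤ l → θ' l = θ l) : A.acceptingStates w i θ' = A.acceptingStates w i θ := by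
  ext q
  exact ⟨fun hq φ hφ => hq φ fun l hl => (hφ l hl).trans (h l hl).symm,
    fun hq φ hφ => hq φ fun l hl => (hφ l hl).trans (h l hl)⟩

variable {A w}

/-- A step is a move along an enabled transition. -/
theorem step_iff (γ γ' : PebbleConfig k A.State w.length) :
    A.Step w γ γ' ↔ ∃ t ∈ A.enabledTrans γ.head (labelAt w (γ.pos γ.head))
      (equalPebbles view w γ.head γ.pos) γ.state,
        γ'.state = t.target ∧ PebbleMove t.act γ.head γ.pos γ'.head γ'.pos := by
  constructor
  · rintro ⟨t, ht, ⟨h1, h2, h3, h4⟩, hs, hm⟩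
    refine ⟨t, ⟨ht, ?_, h1, h4.symm, h3, h2⟩, hs, hm⟩
    unfold PebbleTransition.Enabled
    generalize t.act = a at hm
    obtain ⟨i, q, θ⟩ := γ
    obtain ⟨j, q', θ'⟩ := γ'
    simp only at *
    subst h1
    cases hm with
    | stay => trivial
    | right _ _ p hp =>
      simp only
      rw [← h4, Ne, labelAt_eq_rightEnd_iff]
      have := p.2
      omega
    | placePebble _ _ _ hj => simp only; omega
    | liftPebble _ _ _ hj => simp only; have := j.2; omega
  · rintro ⟨t, ⟨ht, -, h1, h4, h3, h2⟩, hs, hm⟩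
    exact ⟨t, ht, ⟨h1, h2, h3, h4.symm⟩, hs, hm⟩

theorem exists_move_of_enabled {t : PebbleTransition α k A.State} {θ : Fin k → Fin (w.length + 2)}
    (ht : t.Enabled) (hl : t.label = labelAt w (θ t.head)) :
    ∃ j θ', PebbleMove t.act t.head θ j θ' := by
  unfold PebbleTransition.Enabled at ht
  cases ha : t.act <;> simp only [ha] at ht
  · exact ⟨_, _, .stay _ _⟩
  · rw [hl, Ne, labelAt_eq_rightEnd_iff] at ht
    exact ⟨_, _, .right _ _ ⟨θ t.head + 1, by omega⟩ rfl⟩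
  · exact ⟨_, _, .placePebble _ ⟨t.head - 1, by omega⟩ _ (by simp only; omega)⟩
  · exact ⟨_, _, .liftPebble _ ⟨t.head + 1, ht⟩ _ rfl⟩

variable (A w)

theorem value_subset_acceptingStates (i : Fin k) (θ : Fin k → Fin (w.length + 2))
    (X : Set A.State) (hX : ∀ m : Fin k, (m : ℕ) = i + 1 → X ⊆ A.acceptingStates w m θ) :
    A.value w i θ X ⊆ A.acceptingStates w i θ := by
  have hplace : ∀ j : Fin k, (j : ℕ) + 1 = i → A.placeValue w i θ (A.acceptingStates w i θ) ⊆
      A.acceptingStates w j (Function.update θ j (θ i)) := by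
    intro j hj
    rw [A.placeValue_eq w hj]
    -- Lifting `j` gives the head back to pebble `i`, which has not moved; so the accepting states
    -- at `i` are a valid return set.
    refine value_subset_acceptingStates _ _ _ fun m hm => ?_
    obtain rfl : m = i := Fin.ext (by omega)
    rw [A.acceptingStates_congr w m θ (Function.update θ j (θ m))]
    exact fun l hl => Function.update_of_ne (ne_of_gt
      (lt_of_lt_of_le (Fin.lt_def.2 (by omega)) hl)) _ _
  have hright : ∀ p : Fin (w.length + 2), (p : ℕ) = θ i + 1 → A.rightValue w i θ X ⊆
      A.acceptingStates w i (Function.update θ i p) := by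
    intro p hp
    rw [A.rightValue_eq w hp]
    refine value_subset_acceptingStates _ _ _ fun m hm => ?_
    rw [A.acceptingStates_congr w m θ]
    · exact hX m hm
    · exact fun l hl => Function.update_of_ne (ne_of_gt
        (lt_of_lt_of_le (Fin.lt_def.2 (by omega)) hl)) _ _
  rw [value_eq]
  -- By leastness it is enough that the accepting states are closed under `evalStep`.
  refine A.evalLocal_subset _ _ _ fun q hq θ' hθ' => ?_
  rw [← hθ' i le_rfl, ← equalPebbles_congr view w hθ'] at hq
  have key : ∀ t ∈ A.enabledTrans i (labelAt w (θ' i)) (equalPebbles view w i θ') q,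
      t.Succeeds (A.placeValue w i θ) X (A.rightValue w i θ X) (A.acceptingStates w i θ) →
      ∀ j φ, PebbleMove t.act i θ' j φ → A.LeadsToAcceptance w ⟨j, t.target, φ⟩ := by
    rintro t - hs j φ hm
    unfold PebbleTransition.Succeeds at hs
    generalize t.act = a at hs hm
    cases hm with
    | stay => exact hs θ' hθ'
    | right _ _ p hp =>
      rw [hθ' i le_rfl] at hp
      exact hright p hp hs _ (update_congr_above _ (by omega) hθ')
    | placePebble _ _ _ hj =>
      rw [hθ' i le_rfl]
      exact hplace j hj hs _ (update_congr_above _ (by omega) hθ')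
    | liftPebble _ _ _ hj =>
      exact hX j hj hs θ' fun l hl => hθ' l (le_trans (Fin.le_def.2 (by omega)) hl)
  rcases hq with hF | ⟨hU, h⟩ | ⟨hF, hU, t, ht, h⟩
  · exact .final _ hF
  · refine .univ _ hU fun γ' hs => ?_
    obtain ⟨t, ht, hst, hm⟩ := (step_iff _ _).1 hs
    have := key t ht (h t ht) _ _ hm
    rwa [← hst] at this
  · obtain ⟨j, φ, hm⟩ := exists_move_of_enabled (θ := θ') ht.2.1
      (by rw [ht.2.2.1]; exact ht.2.2.2.1)
    rw [ht.2.2.1] at hm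
    exact .exist _ ⟨j, t.target, φ⟩ hF hU ((step_iff _ _).2 ⟨t, ht, rfl, hm⟩)
      (key t ht h j φ hm)
termination_by ((i : ℕ), w.length + 2 - (θ i : ℕ))
decreasing_by
  · exact Prod.Lex.left _ _ (by omega)
  · exact Prod.Lex.right _ (by simp only [Function.update_self]; omega)

/-! ### Completeness of the values -/

/-- The states that lead to acceptance with head pebble `i`, computed from those for the earlier
pebbles. -/
def stackValue (i : Fin k) (θ : Fin k → Fin (w.length + 2)) : Set A.State :=
  A.value w i θ (if h : (i : ℕ) + 1 < k then stackValue ⟨i + 1, h⟩ θ else ∅)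
termination_by k - i
decreasing_by omega

/-- The states accepting after lifting pebble `i`. -/
def liftValue (i : Fin k) (θ : Fin k → Fin (w.length + 2)) : Set A.State :=
  if h : (i : ℕ) + 1 < k then A.stackValue w ⟨i + 1, h⟩ θ else ∅

theorem stackValue_eq (i : Fin k) (θ : Fin k → Fin (w.length + 2)) :
    A.stackValue w i θ = A.value w i θ (A.liftValue w i θ) := by
  rw [stackValue]
  rfl

theorem stackValue_congr (i : Fin k) (θ θ' : Fin k → Fin (w.length + 2))
    (h : ∀ l, i ≤ l → θ' l = θ l) : A.stackValue w i θ' = A.stackValue w i θ := by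
  rw [stackValue_eq, stackValue_eq, A.value_congr w i θ θ' h]
  congr 1
  unfold liftValue
  split_ifs with hk
  · exact stackValue_congr _ _ _ fun l hl => h l (le_trans (Fin.le_def.2 (by simp)) hl)
  · rfl
termination_by k - i
decreasing_by omega

theorem liftValue_eq {i j : Fin k} (hj : (j : ℕ) = i + 1) (θ : Fin k → Fin (w.length + 2)) :
    A.liftValue w i θ = A.stackValue w j θ := by
  have h : (i : ℕ) + 1 < k := by omega
  obtain rfl : j = ⟨i + 1, h⟩ := Fin.ext hj
  simp only [liftValue, dif_pos h]

theorem liftValue_congr (i : Fin k) (θ θ' : Fin k → Fin (w.length + 2))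
    (h : ∀ l, i < l → θ' l = θ l) : A.liftValue w i θ' = A.liftValue w i θ := by
  unfold liftValue
  split_ifs with hk
  · exact A.stackValue_congr w _ _ _ fun l hl =>
      h l (lt_of_lt_of_le (Fin.lt_def.2 (by simp)) hl)
  · rfl

/-- A move right leaves the lift value unchanged; after placing, the lift value of the new pebble is
the `stackValue` of the old one. -/
theorem succeeds_of_move {i j : Fin k} {θ φ : Fin k → Fin (w.length + 2)}
    {t : PebbleTransition α k A.State} (hm : PebbleMove t.act i θ j φ)
    (ht : t.target ∈ A.stackValue w j φ) :
    t.Succeeds (A.placeValue w i θ) (A.liftValue w i θ)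
      (A.rightValue w i θ (A.liftValue w i θ)) (A.stackValue w i θ) := by
  unfold PebbleTransition.Succeeds
  generalize t.act = a at hm
  cases hm with
  | stay => exact ht
  | right _ _ p hp =>
    simp only [A.rightValue_eq w hp]
    rwa [stackValue_eq, A.liftValue_congr w i θ] at ht
    exact fun l hl => Function.update_of_ne hl.ne' _ _
  | placePebble _ _ _ hj =>
    simp only [A.placeValue_eq w hj]
    rwa [stackValue_eq, A.liftValue_eq w hj.symm, A.stackValue_congr w i θ] at ht
    exact fun l hl => Function.update_of_ne (ne_of_gt
      (lt_of_lt_of_le (Fin.lt_def.2 (by omega)) hl)) _ _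
  | liftPebble _ _ _ hj =>
    simp only [A.liftValue_eq w hj]
    exact ht

variable {A w}

/-- Induction on the derivation, since `stackValue` is closed under `evalStep`. -/
theorem LeadsToAcceptance.mem_stackValue {γ : PebbleConfig k A.State w.length}
    (h : A.LeadsToAcceptance w γ) : γ.state ∈ A.stackValue w γ.head γ.pos := by
  have key : ∀ i θ, A.evalStep i (labelAt w (θ i)) (equalPebbles view w i θ) (A.placeValue w i θ)
      (A.liftValue w i θ) (A.rightValue w i θ (A.liftValue w i θ)) (A.stackValue w i θ) ⊆
      A.stackValue w i θ := by
    intro i θ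
    rw [stackValue_eq, value_eq]
    exact A.evalStep_evalLocal_subset _ _ _ (A.placeValue_mono w i θ)
  induction h with
  | final γ hF => exact key _ _ (Or.inl hF)
  | univ γ hU _ ih =>
    refine key _ _ (Or.inr (Or.inl ⟨hU, fun t ht => ?_⟩))
    obtain ⟨j, φ, hm⟩ := exists_move_of_enabled (θ := γ.pos) ht.2.1
      (by rw [ht.2.2.1]; exact ht.2.2.2.1)
    rw [ht.2.2.1] at hm
    exact A.succeeds_of_move w hm (ih ⟨j, t.target, φ⟩ ((step_iff _ _).2 ⟨t, ht, rfl, hm⟩))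
  | exist γ γ' hF hU hs _ ih =>
    obtain ⟨t, ht, hst, hm⟩ := (step_iff _ _).1 hs
    exact key _ _ (Or.inr (Or.inr ⟨hF, hU, t, ht, A.succeeds_of_move w hm (hst ▸ ih)⟩))

theorem mem_language_iff [NeZero k] (A : WeakPA view α k) (w : List (α × D)) :
    w ∈ A.language D ↔ A.initial ∈ A.value w ⊤ (fun _ => 0) ∅ := by
  have htop := not_top_val_add_one_lt k
  constructor
  · intro h
    have := LeadsToAcceptance.mem_stackValue h
    rw [stackValue_eq, liftValue] at this
    rw [dif_neg (by exact htop)] at this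
    exact this
  · intro h
    exact A.value_subset_acceptingStates w _ _ _ (fun m hm => absurd (hm ▸ m.2) htop) h _ fun _ _ => rfl

end Value

/-! ### Automata given by a transition function -/

/-- The weak automaton, without universal states, whose transitions are given by a function. -/
def ofFunction (view : PebbleView) (S : Type) [Finite S] (s₀ : S) (F : Set S)
    (δ : Fin k → Marked α → Set (Fin k) → S → S × PebbleAction) : WeakPA view α k where
  State := S
  finite_state := inferInstance
  initial := s₀
  final := F
  univ := ∅
  univ_subset := Set.empty_subset _
  trans := {t | t.equal ⊆ view.scope t.head ∧
    (t.target, t.act) = δ t.head t.label t.equal t.source}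
  equal_subset := fun _ ht => ht.1

section OfFunction

variable {S : Type} [Finite S] (s₀ : S) (F : Set S)
  (δ : Fin k → Marked α → Set (Fin k) → S → S × PebbleAction)

theorem isDeterministic_ofFunction (D : Type*) : (ofFunction view S s₀ F δ).IsDeterministic D := by
  intro w γ
  refine ⟨⟨γ.head, labelAt w (γ.pos γ.head), equalPebbles view w γ.head γ.pos, γ.state,
    (δ γ.head (labelAt w (γ.pos γ.head)) (equalPebbles view w γ.head γ.pos) γ.state).1,
    (δ γ.head (labelAt w (γ.pos γ.head)) (equalPebbles view w γ.head γ.pos) γ.state).2⟩,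
    ⟨⟨fun l hl => hl.1, rfl⟩, rfl, rfl, rfl, rfl⟩, ?_⟩
  rintro ⟨i, σ, V, q, p, a⟩ ⟨⟨-, hδ⟩, h1, h2, h3, h4⟩
  simp only at hδ h1 h2 h3 h4
  subst h1 h2 h3 h4
  rw [Prod.ext_iff] at hδ
  obtain ⟨rfl, rfl⟩ := hδ
  rfl

theorem leadsToAcceptance_ofFunction_iff {w : List (α × D)} {i j : Fin k} {s s' : S}
    {θ φ : Fin k → Fin (w.length + 2)} {a : PebbleAction} (hF : s ∉ F)
    (hδ : δ i (labelAt w (θ i)) (equalPebbles view w i θ) s = (s', a))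
    (hm : PebbleMove a i θ j φ) :
    (ofFunction view S s₀ F δ).LeadsToAcceptance w ⟨i, s, θ⟩ ↔
      (ofFunction view S s₀ F δ).LeadsToAcceptance w ⟨j, s', φ⟩ := by
  constructor
  · intro h
    cases h with
    | final _ h => exact absurd h hF
    | univ _ h => exact absurd h (Set.notMem_empty _)
    | exist _ γ' _ _ hs h =>
      obtain ⟨t, ⟨-, ht⟩, ⟨h1, h2, h3, h4⟩, hst, hm'⟩ := hs
      simp only at h1 h2 h3 h4 hm'
      rw [h1, h2, ← h4, h3] at ht
      have ht' := ht.trans hδ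
      rw [Prod.ext_iff] at ht'
      obtain ⟨hs', ha⟩ := ht'
      simp only at hs' ha
      rw [ha] at hm'
      obtain ⟨hj, hφ⟩ := hm.unique hm'
      obtain ⟨i', q', θ'⟩ := γ'
      simp only at hj hφ hst
      subst hj hφ hst
      rwa [hs'] at h
  · intro h
    exact .exist _ ⟨j, s', φ⟩ hF (Set.notMem_empty _)
      ⟨⟨i, labelAt w (θ i), equalPebbles view w i θ, s, s', a⟩,
        ⟨fun l hl => hl.1, hδ.symm⟩, ⟨rfl, rfl, rfl, rfl⟩, rfl, hm⟩ h

end OfFunction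

/-! ### The determinized automaton -/

/-- The phases of the determinized automaton with head pebble `i`: about to place pebble `i - 1`,
back from it with its value as a function of the states accepting after lifting, at the right end
with the value for pebble `i` itself, or stopped with a verdict. -/
inductive Phase (Q : Type)
  | search
  | resume (G : Set Q → Set Q)
  | finish (H : Set Q → Set Q)
  | verdict (b : Prop)

instance (Q : Type) [Finite Q] : Finite (Phase Q) :=
  Finite.of_injective (β := Option ((Set Q → Set Q) ⊕ (Set Q → Set Q) ⊕ Prop))
    (fun
      | .search => none
      | .resume G => some (.inl G)
      | .finish H => some (.inr (.inl H))
      | .verdict b => some (.inr (.inr b)))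
    (by rintro (_ | _ | _ | _) (_ | _ | _ | _) <;> simp)

/-- A state of the determinized automaton: for each pebble, the value at its starting position as a
function of the states accepting after lifting it and of those accepting at its current position;
and the phase. -/
abbrev DetState (k : ℕ) (Q : Type) : Type :=
  (Fin k → Set Q → Set Q → Set Q) × Phase Q

open Classical in
/-- The transition function of the determinized automaton. -/
noncomputable def detTrans (A : WeakPA view α k) (i : Fin k) (σ : Marked α) (V : Set (Fin k)) :
    DetState k A.State → DetState k A.State × PebbleAction
  | (acc, .search) =>
    if 0 < (i : ℕ) then
      -- The new pebble is still at its starting position, so its accumulated map returns `R`.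
      ((Function.update acc ⟨i - 1, by omega⟩ fun _ R => R, .search), .placePebble)
    else ((acc, .resume fun _ => ∅), .stay)
  | (acc, .resume G) =>
    if σ = Marked.rightEnd then
      ((acc, .finish fun X => acc i X (A.evalLocal i σ V G X ∅)), .stay)
    else
      -- The argument `X` stays free because the simulated pebble may be lifted at any position it
      -- passes.
      ((Function.update acc i fun X R => acc i X (A.evalLocal i σ V G X R), .search), .right)
  | (acc, .finish H) =>
    if (i : ℕ) + 1 < k then ((acc, .resume H), .liftPebble)
    else ((acc, .verdict (A.initial ∈ H ∅)), .stay)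
  | (acc, .verdict b) => ((acc, .verdict b), .stay)

/-- The determinized automaton. -/
noncomputable def determinize (A : WeakPA view α k) : WeakPA view α k :=
  have := A.finite_state
  ofFunction view (DetState k A.State) (fun _ _ R => R, .search) {s | s.2 = .verdict True}
    A.detTrans

section Determinize

variable (A : WeakPA view α k) (w : List (α × D))

theorem isDeterministic_determinize (D : Type*) : A.determinize.IsDeterministic D :=
  have := A.finite_state
  isDeterministic_ofFunction _ _ _ D

/-- The determinized automaton accepts from the head pebble `i`, the state `s` and the assignment
`θ`. -/
def DetAccepts (i : Fin k) (s : DetState k A.State) (θ : Fin k → Fin (w.length + 2)) : Prop :=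
  A.determinize.LeadsToAcceptance w ⟨i, s, θ⟩

variable {A w}

theorem detAccepts_iff {i j : Fin k} {s s' : DetState k A.State}
    {θ φ : Fin k → Fin (w.length + 2)} {a : PebbleAction} (hF : s.2 ≠ .verdict True)
    (hδ : A.detTrans i (labelAt w (θ i)) (equalPebbles view w i θ) s = (s', a))
    (hm : PebbleMove a i θ j φ) : A.DetAccepts w i s θ ↔ A.DetAccepts w j s' φ :=
  have := A.finite_state
  leadsToAcceptance_ofFunction_iff _ _ _ hF hδ hm

theorem detAccepts_verdict_iff {i : Fin k} {acc : Fin k → Set A.State → Set A.State → Set A.State}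
    {b : Prop} {θ : Fin k → Fin (w.length + 2)} :
    A.DetAccepts w i (acc, .verdict b) θ ↔ b := by
  constructor
  -- A verdict only loops, so a derivation of acceptance must end in the same verdict.
  · suffices key : ∀ γ, A.determinize.LeadsToAcceptance w γ →
        ∀ acc b, γ.state = (acc, .verdict b) → b
      from fun h => key _ h acc b rfl
    intro γ h
    induction h with
    | final γ hF =>
      intro acc b hb
      have hF' : γ.state.2 = .verdict True := hF
      rw [hb] at hF'
      simpa using hF'
    | univ γ hU => exact absurd hU (Set.notMem_empty _)
    | exist γ γ' _ _ hs _ ih =>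
      intro acc b hb
      obtain ⟨t, ⟨-, ht⟩, ⟨-, h2, -, -⟩, hst, -⟩ := hs
      rw [h2, hb, Prod.ext_iff] at ht
      exact ih acc b (hst.trans ht.1)
  · intro hb
    refine .final _ ?_
    change Phase.verdict b = .verdict True
    rw [eq_true hb]

variable (A w)

/-- The map `acc` is arbitrary because each step to the right changes it. On return, only the data
of the pebbles above `i` are guaranteed to be intact. -/
theorem exists_detAccepts_finish (i : Fin k)
    (acc : Fin k → Set A.State → Set A.State → Set A.State) (θ : Fin k → Fin (w.length + 2)) :
    ∃ acc' θ', (∀ l, i < l → acc' l = acc l ∧ θ' l = θ l) ∧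
      (A.DetAccepts w i (acc, .search) θ ↔
        A.DetAccepts w i (acc', .finish fun X => acc i X (A.value w i θ X)) θ') := by
  have hplace : ∃ acc' θ', (∀ l, i ≤ l → acc' l = acc l ∧ θ' l = θ l) ∧
      (A.DetAccepts w i (acc, .search) θ ↔
        A.DetAccepts w i (acc', .resume (A.placeValue w i θ)) θ') := by
    by_cases h0 : 0 < (i : ℕ)
    · obtain ⟨j, hj⟩ : ∃ j : Fin k, (j : ℕ) + 1 = i := ⟨⟨i - 1, by omega⟩, by simp only; omega⟩
      have hji : j < i := Fin.lt_def.2 (by omega)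
      -- Started with the map `fun _ R => R`, pebble `j` returns with exactly its value, which is
      -- `placeValue` for `i`.
      obtain ⟨acc', θ', hagree, h⟩ := exists_detAccepts_finish j
        (Function.update acc j fun _ R => R) (Function.update θ j (θ i))
      refine ⟨acc', θ', fun l hl => ?_, ?_⟩
      · have hjl := lt_of_lt_of_le hji hl
        obtain ⟨h1, h2⟩ := hagree l hjl
        rw [Function.update_of_ne hjl.ne'] at h1 h2
        exact ⟨h1, h2⟩
      · refine ((detAccepts_iff (by simp) ?_ (.placePebble i j θ hj)).trans h).trans
          (detAccepts_iff (by simp) ?_ (.liftPebble j i θ' hj.symm))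
        · have hj' : (⟨i - 1, by omega⟩ : Fin k) = j := Fin.ext (by simp only; omega)
          simp only [detTrans, if_pos h0, hj']
        · have hk : (j : ℕ) + 1 < k := by omega
          simp only [detTrans, if_pos hk, Function.update_self, A.placeValue_eq w hj]
    · refine ⟨acc, θ, fun _ _ => ⟨rfl, rfl⟩, detAccepts_iff (by simp) ?_ (.stay _ _)⟩
      have : A.placeValue w i θ = fun _ => ∅ := funext fun Y => if_neg h0
      simp only [detTrans, if_neg h0, this]
  obtain ⟨acc₁, θ₁, hagree, h₁⟩ := hplace
  obtain ⟨hacc, hθ⟩ := hagree i le_rfl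
  have hV := equalPebbles_congr view w fun l hl => (hagree l hl).2
  by_cases hend : labelAt w (θ i) = Marked.rightEnd
  · refine ⟨acc₁, θ₁, fun l hl => hagree l hl.le, h₁.trans
      (detAccepts_iff (by simp) ?_ (.stay _ _))⟩
    have hval : ∀ X, A.value w i θ X = A.evalLocal i (labelAt w (θ i)) (equalPebbles view w i θ)
        (A.placeValue w i θ) X ∅ := by
      intro X
      rw [labelAt_eq_rightEnd_iff] at hend
      rw [value_eq, rightValue, dif_neg (by omega)]
    simp only [detTrans, hacc, hV, hval]
    rw [hθ, if_pos hend]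
  · have hlt : (θ i : ℕ) + 1 < w.length + 2 := by
      rw [labelAt_eq_rightEnd_iff] at hend
      omega
    obtain ⟨p, hp⟩ : ∃ p : Fin (w.length + 2), (p : ℕ) = θ i + 1 := ⟨⟨_, hlt⟩, rfl⟩
    -- The extended map at the next position gives back `acc i X (A.value w i θ X)`, by `value_eq`.
    obtain ⟨acc₂, θ₂, hagree₂, h₂⟩ := exists_detAccepts_finish i
      (Function.update acc₁ i fun X R => acc i X (A.evalLocal i (labelAt w (θ i))
        (equalPebbles view w i θ) (A.placeValue w i θ) X R)) (Function.update θ₁ i p)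
    refine ⟨acc₂, θ₂, fun l hl => ?_, ?_⟩
    · obtain ⟨h3, h4⟩ := hagree₂ l hl
      rw [Function.update_of_ne hl.ne'] at h3 h4
      exact ⟨h3.trans (hagree l hl.le).1, h4.trans (hagree l hl.le).2⟩
    · have hval : ∀ X, A.value w i (Function.update θ₁ i p) X = A.rightValue w i θ X := by
        intro X
        rw [A.rightValue_eq w hp, A.value_congr w i (Function.update θ i p)]
        exact update_congr_above _ (by omega) fun l hl => (hagree l hl).2
      simp only [Function.update_self, hval, ← value_eq] at h₂
      refine h₁.trans ((detAccepts_iff (by simp) ?_ (.right i θ₁ p (by rw [hθ, hp]))).trans h₂)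
      simp only [detTrans, hacc, hV]
      rw [hθ, if_neg hend]
termination_by ((i : ℕ), w.length + 2 - (θ i : ℕ))
decreasing_by
  · exact Prod.Lex.left _ _ (by omega)
  · exact Prod.Lex.right _ (by simp only [Function.update_self]; omega)

end Determinize

/-! ### Equality of languages and the equivalences -/

theorem language_determinize [NeZero k] (A : WeakPA view α k) (D : Type*) :
    A.determinize.language D = A.language D := by
  ext w
  rw [mem_language_iff A]
  have htop := not_top_val_add_one_lt k
  obtain ⟨acc', θ', -, h⟩ := A.exists_detAccepts_finish w ⊤ (fun _ _ R => R) (fun _ => 0)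
  refine h.trans ((detAccepts_iff (by simp) ?_ (.stay _ _)).trans
    (detAccepts_verdict_iff (acc := acc')))
  simp only [detTrans, if_neg htop]

theorem tfae_language [NeZero k] (view : PebbleView) (L : Set (List (α × D))) :
    [∃ A : WeakPA view α k, A.language D = L,
      ∃ A : WeakPA view α k, A.IsNondeterministic ∧ A.language D = L,
      ∃ A : WeakPA view α k, A.IsDeterministic D ∧ A.language D = L,
      ∃ A : WeakPA view α k,
        A.IsDeterministic D ∧ A.IsNondeterministic ∧ A.language D = L].TFAE := by
  tfae_have 1 → 4 := fun ⟨A, hA⟩ =>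
    ⟨A.determinize, A.isDeterministic_determinize D, rfl, (A.language_determinize D).trans hA⟩
  tfae_have 4 → 2 := fun ⟨A, _, hn, hA⟩ => ⟨A, hn, hA⟩
  tfae_have 4 → 3 := fun ⟨A, hd, _, hA⟩ => ⟨A, hd, hA⟩
  tfae_have 2 → 1 := fun ⟨A, _, hA⟩ => ⟨A, hA⟩
  tfae_have 3 → 1 := fun ⟨A, _, hA⟩ => ⟨A, hA⟩
  tfae_finish

end WeakPA

theorem mainTheorem4 {α D : Type*} [Finite α] [Infinite D] (k : ℕ) [NeZero k]
    (L : Set (List (α × D))) :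
    [∃ A : WeakPA .full α k, A.language D = L,
      ∃ A : WeakPA .full α k, A.IsNondeterministic ∧ A.language D = L,
      ∃ A : WeakPA .full α k, A.IsDeterministic D ∧ A.language D = L,
      ∃ A : WeakPA .full α k,
        A.IsDeterministic D ∧ A.IsNondeterministic ∧ A.language D = L].TFAE ∧
    [∃ A : WeakPA .top α k, A.language D = L,
      ∃ A : WeakPA .top α k, A.IsNondeterministic ∧ A.language D = L,
      ∃ A : WeakPA .top α k, A.IsDeterministic D ∧ A.language D = L,
      ∃ A : WeakPA .top α k,
        A.IsDeterministic D ∧ A.IsNondeterministic ∧ A.language D = L].TFAE := 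
  ⟨WeakPA.tfae_language _ L, WeakPA.tfae_language _ L⟩
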